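/- **Setting.** Let $(X_n)_{n\in V\sqcup L}$ be a causal graphical model on a finite DAG with observed variables $X_v$ ($v\in V$) and latent variables $X_l$ ($l\in L$), with arbitrary (discrete, continuous or mixed) domains and densities with respect to $\sigma$-finite reference measures: the observational density is $p(x)=\prod_n p(x_n\mid x_{\mathrm{pa}(n)})$. For every observed $X_k$ there is a perfect stochastic intervention, which replaces $p(x_k\mid x_{\mathrm{pa}(k)})$ by a density $\tilde p_k(x_k)$; let $\tilde p_{I_k}$ be the resulting joint distribution. Intervention targets are drawn from a distribution $p_I$ on $V$ with $p_I(k)>0$ for all $k$. Write $p(X_j\mid X_S)$, $S\subseteq V\setminus\{j\}$, for the (versions of the) observational conditional densities, which are assumed to be modelled exactly by the learned networks, and $\mathrm{pa}(X_j)$ for the set of observed parents of $X_j$. Let $\sigma$ be the sigmoid function and $\lambda_{\rm sparse}>0$. **Algorithm (ENCO graph fitting in the data limit).** The parameters are $\gamma_{ij}=\gamma^{(I)}_{ij}+\gamma^{(O)}_{ij}$ and $\theta_{ij}=-\theta_{ji}$ ($i\ne j$ in $V$), and adjacency matrices $C$ have independent entries $C_{ij}\sim\mathrm{Ber}(\sigma(\gamma_{ij})\sigma(\theta_{ij}))$.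 For an intervention target $k$ put $$T^{(k)}_{ij}=\mathbb E_{C_{-ij}}\,\mathbb E_{\tilde p_{I_k}}\big[-\log p(X_j\mid X_S,X_i)+\log p(X_j\mid X_S)\big],\qquad S=\{m\ne i,j: C_{mj}=1\},$$ and $g^{(k)}_{ij}=\sigma'(\gamma_{ij})\,\sigma(\theta_{ij})\,\big(T^{(k)}_{ij}+\lambda_{\rm sparse}\big)$. From an arbitrary starting point, gradient descent with learning rates $\eta_\gamma,\eta_\theta>0$ iterates simultaneously $$\gamma^{(I)}_{ij}\leftarrow\gamma^{(I)}_{ij}-\eta_\gamma\,p_I(i)\,g^{(i)}_{ij},\qquad \gamma^{(O)}_{ij}\leftarrow\gamma^{(O)}_{ij}-\eta_\gamma\sum_{k\ne i,j}p_I(k)\,g^{(k)}_{ij},$$ $$\theta_{ij}\leftarrow\theta_{ij}-\eta_\theta\,\sigma'(\theta_{ij})\big(p_I(i)\,\sigma(\gamma_{ij})\,T^{(i)}_{ij}-p_I(j)\,\sigma(\gamma_{ji})\,T^{(j)}_{ji}\big).$$ **Theorem.** Let $X_i\neq X_j$ be observed variables, neither of which is an ancestor of the other, that share a latent confounder $X_l$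 (a common parent that is not a child of any observed variable), and suppose that $X_i$ and $X_j$ are conditionally independent given $X_l$ and their observed parents. Suppose that for $v\in\{i,j\}$ the log-likelihoods $\log p(X_v\mid X_S)$, $S\subseteq V\setminus\{v\}$, are finite almost surely and integrable under all interventions on variables other than $X_v$. Suppose that all other edges into $X_i$ and $X_j$ have been recovered: along the run, for $v\in\{i,j\}$ and $k\notin\{i,j\}$, the edge probability $\sigma(\gamma_{kv})\sigma(\theta_{kv})$ converges to $1$ if $X_k\to X_v$ is an edge of the causal graph and to $0$ otherwise. If, with $\hat I$ drawn from $p_I$ conditioned on the target being neither $X_i$ nor $X_j$, $$\mathbb E_{\hat I}\,\mathbb E_{\tilde p_{\hat I}}\big[\log p(X_j\mid \mathrm{pa}(X_j),X_i)-\log p(X_j\mid \mathrm{pa}(X_j))\big]>\lambda_{\rm sparse},$$ $$\mathbb E_{\hat I}\,\mathbb E_{\tilde p_{\hat I}}\big[\log p(X_i\mid \mathrm{pa}(X_i),X_j)-\log p(X_i\mid \mathrm{pa}(X_i))\big]>\lambda_{\rm sparse},$$ then along the run the confounder score $$\mathrm{lc}(X_i,X_j)=\sigma(\gamma^{(O)}_{ij})\,\sigma(\gamma^{(O)}_{ji})\,\big(1-\sigma(\gamma^{(I)}_{ij})\big)\big(1-\sigma(\gamma^{(I)}_{ji})\big)$$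 converges to $1$; moreover $\sigma(\gamma^{(O)}_{ij})\to1$, $\sigma(\gamma^{(O)}_{ji})\to1$, $\sigma(\gamma^{(I)}_{ij})\to0$ and $\sigma(\gamma^{(I)}_{ji})\to0$. -/

import Mathlib

open MeasureTheory Filter Topology
open scoped NNReal ENNReal

noncomputable section

namespace ENCO

variable {V L : Type*} [Fintype V] [DecidableEq V] [Fintype L] [DecidableEq L]
variable {Ω : V ⊕ L → Type*} [∀ n, MeasurableSpace (Ω n)]

/-- A causal graphical model with observed variables `V` and latent variables `L`, together with
one perfect stochastic intervention on every observed variable. The variable `n` takes values in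
`Ω n`, and densities on `Ω n` are taken with respect to the reference measure `μ n` (for instance
counting or Lebesgue measure), so that discrete, continuous and mixed models are covered. -/
structure CausalModel (μ : ∀ n : V ⊕ L, Measure (Ω n)) where
  /-- The parents of a node in the causal graph. -/
  pa : V ⊕ L → Finset (V ⊕ L)
  acyclic : ∀ n, ¬ Relation.TransGen (fun a b => a ∈ pa b) n n
  /-- `mech n x` is the conditional density `p (x_n | x_{pa n})`. -/
  mech : ∀ _ : V ⊕ L, (∀ m, Ω m) → ℝ≥0
  measurable_mech : ∀ n, Measurable (mech n)
  dependsOn_mech : ∀ n, DependsOn (mech n) (insert n (pa n : Set (V ⊕ L)))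
  lintegral_mech : ∀ n x, ∫⁻ y, (mech n (Function.update x n y) : ℝ≥0∞) ∂(μ n) = 1
  /-- `intv k` is the density of `X_k` under the intervention on `X_k`; the intervention is perfect,
  i.e. this density does not depend on the parents of `X_k`. -/
  intv : ∀ k : V, Ω (Sum.inl k) → ℝ≥0
  measurable_intv : ∀ k, Measurable (intv k)
  lintegral_intv : ∀ k, ∫⁻ y, (intv k y : ℝ≥0∞) ∂(μ (Sum.inl k)) = 1

namespace CausalModel

variable {μ : ∀ n : V ⊕ L, Measure (Ω n)} (M : CausalModel μ)

/-- `m` is a (proper) ancestor of `n` in the causal graph. -/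
def IsAncestor (m n : V ⊕ L) : Prop := Relation.TransGen (fun a b => a ∈ M.pa b) m n

/-- The observed parents of the observed variable `j`. -/
def obsPa (j : V) : Finset V := Finset.univ.filter fun k => Sum.inl k ∈ M.pa (Sum.inl j)

/-- The latent variable `l` is a common parent of `i` and `j`, and not a child of any observed
variable. -/
def IsLatentConfounder (l : L) (i j : V) : Prop :=
  Sum.inr l ∈ M.pa (Sum.inl i) ∧ Sum.inr l ∈ M.pa (Sum.inl j) ∧
    ∀ k : V, Sum.inl k ∉ M.pa (Sum.inr l)

/-- The observational joint density `∏ n, p (x_n | x_{pa n})`. -/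
def obsDensity (x : ∀ n, Ω n) : ℝ≥0∞ := ∏ n, (M.mech n x : ℝ≥0∞)

/-- The joint density under the intervention on `X_k`: the mechanism of `X_k` is replaced. -/
def intDensity (k : V) (x : ∀ n, Ω n) : ℝ≥0∞ :=
  (M.intv k (x (Sum.inl k)) : ℝ≥0∞) * ∏ n ∈ Finset.univ.erase (Sum.inl k), (M.mech n x : ℝ≥0∞)

/-- The joint distribution of all variables under the intervention on `X_k`. -/
def intMeasure (k : V) : Measure (∀ n, Ω n) := (Measure.pi μ).withDensity (M.intDensity k)

/-- The observational marginal density of the variables in `A`, at `x` (it depends only on the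
coordinates of `x` in `A`); all other variables are integrated out. -/
def marginal (A : Finset (V ⊕ L)) : (∀ n, Ω n) → ℝ≥0∞ := lmarginal μ Aᶜ M.obsDensity

/-- Observed variables as nodes of the causal graph. -/
def nodes (S : Finset V) : Finset (V ⊕ L) := S.map Function.Embedding.inl

/-- Conditional independence of the variables `a` and `b` given the variables in `Z`, under the
observational distribution: `p(x_a, x_b, x_Z) p(x_Z) = p(x_a, x_Z) p(x_b, x_Z)`. -/
def CondIndep (a b : V ⊕ L) (Z : Finset (V ⊕ L)) : Prop :=
  ∀ᵐ x ∂(Measure.pi μ),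
    M.marginal (insert a (insert b Z)) x * M.marginal Z x =
      M.marginal (insert a Z) x * M.marginal (insert b Z) x

/-- A family `f`, where `f j S x` stands for the conditional likelihood that the learned network of
`X_j` assigns to `x_j` given `x_S`. -/
abbrev CondFamily (Ω : V ⊕ L → Type*) := ∀ _ : V, Finset V → (∀ n, Ω n) → ℝ≥0

/-- The networks model all observational conditionals `p (x_j | x_S)` accurately: `f j S` is a
(version of the) conditional density of `X_j` given `X_S` under the observational distribution, i.e.
a normalised density in `x_j` for each `x_S` with `f (x_j | x_S) p (x_S) = p (x_j, x_S)`. Where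
`p (x_S) = 0` the normalised density `f (· | x_S)` is arbitrary. -/
structure IsObsConditional (f : CondFamily Ω) : Prop where
  measurable : ∀ j S, j ∉ S → Measurable (f j S)
  dependsOn : ∀ j S, j ∉ S → DependsOn (f j S) (nodes (L := L) (insert j S) : Set (V ⊕ L))
  lintegral : ∀ j S, j ∉ S → ∀ x,
    ∫⁻ y, (f j S (Function.update x (Sum.inl j) y) : ℝ≥0∞) ∂(μ (Sum.inl j)) = 1
  mul_marginal : ∀ j S, j ∉ S → ∀ᵐ x ∂(Measure.pi μ),
    (f j S x : ℝ≥0∞) * M.marginal (nodes S) x = M.marginal (nodes (insert j S)) x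

/-- The expected log-likelihoods of `X_j` under interventions on other variables are well defined
and finite, for all conditioning sets. -/
def FiniteLogLik (f : CondFamily Ω) (j : V) : Prop :=
  ∀ k, k ≠ j → ∀ S, j ∉ S →
    (∀ᵐ x ∂(M.intMeasure k), 0 < f j S x) ∧
      Integrable (fun x => Real.log (f j S x)) (M.intMeasure k)

/-- The expected negative log-likelihood of `X_j` given `X_S` under the intervention on `X_k`. -/
def expNLL (f : CondFamily Ω) (k j : V) (S : Finset V) : ℝ :=
  ∫ x, -Real.log (f j S x) ∂(M.intMeasure k)

/-- The expected log-likelihood gain `E [log p(X_j | X_S, X_i) - log p(X_j | X_S)]` under the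
intervention on `X_k`. -/
def expGain (f : CondFamily Ω) (k i j : V) (S : Finset V) : ℝ :=
  ∫ x, (Real.log (f j (insert i S) x) - Real.log (f j S x)) ∂(M.intMeasure k)

/-- The interventions with target neither `X_i` nor `X_j`. -/
def others (i j : V) : Finset V := (Finset.univ.erase i).erase j

/-- The expected log-likelihood gain of adding `X_i` to the true observed parents of `X_j`, over
interventions drawn from `pI` conditioned on the target being neither `X_i` nor `X_j`. -/
def avgGain (f : CondFamily Ω) (pI : V → ℝ) (i j : V) : ℝ :=
  (∑ k ∈ others i j, pI k * M.expGain f k i j (M.obsPa j)) / ∑ k ∈ others i j, pI k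

end CausalModel

open CausalModel

/-- The edge probability `σ(γ_ij) σ(θ_ij)`. -/
def edgeProb (γ θ : V → V → ℝ) (i j : V) : ℝ := Real.sigmoid (γ i j) * Real.sigmoid (θ i j)

/-- The probability that the sampled adjacency matrix `C`, with independent entries
`C_kj ~ Ber (σ(γ_kj) σ(θ_kj))`, has `S` as the set of those parents of `X_j` that lie in
`V \ {i, j}`. -/
def parentProb (γ θ : V → V → ℝ) (i j : V) (S : Finset V) : ℝ :=
  (∏ k ∈ S, edgeProb γ θ k j) * ∏ k ∈ others i j \ S, (1 - edgeProb γ θ k j)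

/-- The derivative of the sigmoid function, `σ'(x) = σ(x) (1 - σ(x))`. -/
def sigmoidDeriv (x : ℝ) : ℝ := Real.sigmoid x * (1 - Real.sigmoid x)

variable {μ : ∀ n : V ⊕ L, Measure (Ω n)} (M : CausalModel μ)

/-- The expectation `E_{X, C_{-ij}} [L_{X_i → X_j} (X_j) - L_{X_i ↛ X_j} (X_j)]` under the
intervention on `X_k`. -/
def lossDiff (f : CondFamily Ω) (γ θ : V → V → ℝ) (k i j : V) : ℝ :=
  ∑ S ∈ (others i j).powerset,
    parentProb γ θ i j S * (M.expNLL f k j (insert i S) - M.expNLL f k j S)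

/-- The gradient of the objective with respect to `γ_ij` under the intervention on `X_k`. -/
def edgeGrad (f : CondFamily Ω) (lam : ℝ) (γ θ : V → V → ℝ) (k i j : V) : ℝ :=
  sigmoidDeriv (γ i j) * Real.sigmoid (θ i j) * (lossDiff M f γ θ k i j + lam)

/-- The gradient for the orientation parameter `θ_ij`; only interventions on `X_i` and `X_j`
contribute. -/
def orientGrad (f : CondFamily Ω) (pI : V → ℝ) (γ θ : V → V → ℝ) (i j : V) : ℝ :=
  sigmoidDeriv (θ i j) *
    (pI i * Real.sigmoid (γ i j) * lossDiff M f γ θ i i j -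
      pI j * Real.sigmoid (γ j i) * lossDiff M f γ θ j j i)

/-- The state of the graph parameters: `γ = γI + γO`, and the orientation parameters `θ`. -/
structure Params (V : Type*) where
  γI : V → V → ℝ
  γO : V → V → ℝ
  θ : V → V → ℝ

/-- The edge parameters `γ_ij = γI_ij + γO_ij`. -/
def Params.γ (P : Params V) : V → V → ℝ := fun i j => P.γI i j + P.γO i j

/-- A run of graph fitting in the data limit: gradient descent, along expected gradients over
interventions with targets drawn from `pI`, with learning rate `ηγ` for the edge parameters and `ηθ`
for the orientation parameters. `γI_ij` receives the gradients of `γ_ij` under interventions on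
`X_i`, and `γO_ij` those under all other interventions; `γ_ij` is never updated on interventions on
`X_j`. The starting point is arbitrary. -/
structure IsRun (f : CondFamily Ω) (pI : V → ℝ) (lam ηγ ηθ : ℝ) (P : ℕ → Params V) : Prop where
  antisymm : ∀ t i j, (P t).θ j i = -(P t).θ i j
  stepI : ∀ t i j, i ≠ j → (P (t + 1)).γI i j =
    (P t).γI i j - ηγ * (pI i * edgeGrad M f lam (P t).γ (P t).θ i i j)
  stepO : ∀ t i j, i ≠ j → (P (t + 1)).γO i j =
    (P t).γO i j - ηγ * ∑ k ∈ others i j, pI k * edgeGrad M f lam (P t).γ (P t).θ k i j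
  stepθ : ∀ t i j, i ≠ j → (P (t + 1)).θ i j =
    (P t).θ i j - ηθ * orientGrad M f pI (P t).γ (P t).θ i j

/-- Apart from a possible edge from `i`, the incoming edges of `X_j` have been recovered along the
run: the probability of `X_k → X_j` converges to one if `X_k` is a parent of `X_j` in the causal
graph, and to zero otherwise. -/
def ParentsRecovered (P : ℕ → Params V) (i j : V) : Prop :=
  ∀ k ∈ others i j, Tendsto (fun t => edgeProb (P t).γ (P t).θ k j) atTop
    (𝓝 (if k ∈ M.obsPa j then 1 else 0))

/-- The latent confounder score of the pair `X_i, X_j`. -/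
def lc (P : Params V) (i j : V) : ℝ :=
  Real.sigmoid (P.γO i j) * Real.sigmoid (P.γO j i) *
    (1 - Real.sigmoid (P.γI i j)) * (1 - Real.sigmoid (P.γI j i))

end ENCO

end

/-! Fix the ordered pair (i, j). The updates of `γI i j` and `γO i j` share one nonnegative step
size, `s t = σ'(γ_ij) σ(θ_ij)`, and differ only in the driving term that multiplies it. Once the
other incoming edges of `X_j` are recovered, the sampled parent set concentrates on the true
observed parents, so both driving terms converge to limits given by the expected log-likelihood
gains from adding `X_i` to these parents (`tendsto_lossDiff`).

For interventions on `X_i` the gain is at most zero. `X_j` and its parents lie in an ancestral set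
without `X_i`, so they keep their observational law and are independent of `X_i`; Gibbs' inequality
then applies (`lintegral_ratio_le_one`, `expGain_self_nonpos`). With the sparsity term, the drive of
`γI i j` has a strictly negative limit. For the remaining targets the gain hypothesis makes the
limiting drive of `γO i j` strictly positive.

These signs give divergence only if the total step size is infinite, although `γ_ij` itself is not
controlled and `θ_ij` may drift down and shrink the steps. But finite total step size would make
`γ_ij` converge, then force `σ(θ_ij)` to be summable and `θ_ij` to converge, contradicting `σ > 0`
(`not_summable_step`). Hence `γI i j → -∞` and `γO i j → ∞`; exchanging i and j gives the rest. -/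

namespace ENCO

/-! ### Gradient descent with vanishing step sizes -/

section Descent

/-- A sequence whose increments are `s t * b t`, with `s` summable and `b` bounded, converges. -/
theorem exists_tendsto_of_step {x s b : ℕ → ℝ} {C : ℝ} (hs : ∀ t, 0 ≤ s t) (hsum : Summable s)
    (hb : ∀ t, |b t| ≤ C) (hx : ∀ t, x (t + 1) = x t + s t * b t) :
    ∃ X, Tendsto x atTop (𝓝 X) := by
  have h1 : Summable fun t => s t * b t := by
    refine Summable.of_norm_bounded (hsum.mul_right C) fun t => ?_
    rw [Real.norm_eq_abs, abs_mul, abs_of_nonneg (hs t)]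
    exact mul_le_mul_of_nonneg_left (hb t) (hs t)
  have h2 : ∀ t, x t = x 0 + ∑ k ∈ Finset.range t, s k * b k := by
    intro t
    induction t with
    | zero => simp
    | succ t ih => rw [Finset.sum_range_succ, hx, ih, add_assoc]
  exact ⟨_, (h1.hasSum.tendsto_sum_nat.const_add (x 0)).congr fun t => (h2 t).symm⟩

/-- A sequence whose increments are `s t * b t`, with `s` nonnegative and not summable and `b`
converging to a positive limit, diverges to infinity. -/
theorem tendsto_atTop_of_step {x s b : ℕ → ℝ} {B : ℝ} (hs : ∀ t, 0 ≤ s t) (hsum : ¬ Summable s)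
    (hb : Tendsto b atTop (𝓝 B)) (hB : 0 < B) (hx : ∀ t, x (t + 1) = x t + s t * b t) :
    Tendsto x atTop atTop := by
  obtain ⟨N, hN⟩ := eventually_atTop.1 (hb.eventually (lt_mem_nhds (half_lt_self hB)))
  have h2 : ∀ n, x N + (∑ k ∈ Finset.range n, s (k + N)) * (B / 2) ≤ x (n + N) := by
    intro n
    induction n with
    | zero => simp
    | succ n ih =>
      have h3 := mul_le_mul_of_nonneg_left (hN (n + N) (Nat.le_add_left _ _)).le (hs (n + N))
      rw [Finset.sum_range_succ, show n + 1 + N = n + N + 1 by ring, hx]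
      linarith
  rw [← tendsto_add_atTop_iff_nat N]
  refine tendsto_atTop_mono h2 (tendsto_atTop_add_const_left _ _ ?_)
  refine Tendsto.atTop_mul_const (half_pos hB) ?_
  rw [← not_summable_iff_tendsto_nat_atTop_of_nonneg fun t => hs _]
  rwa [summable_nat_add_iff N]

theorem tendsto_atBot_of_step {x s b : ℕ → ℝ} {B : ℝ} (hs : ∀ t, 0 ≤ s t) (hsum : ¬ Summable s)
    (hb : Tendsto b atTop (𝓝 B)) (hB : B < 0) (hx : ∀ t, x (t + 1) = x t + s t * b t) :
    Tendsto x atTop atBot := by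
  rw [← tendsto_neg_atTop_iff]
  refine tendsto_atTop_of_step (b := fun t => - b t) hs hsum hb.neg (neg_pos.2 hB) fun t => ?_
  rw [hx]
  ring

theorem sigmoidDeriv_pos (x : ℝ) : 0 < sigmoidDeriv x :=
  mul_pos (Real.sigmoid_pos x) (sub_pos.2 (Real.sigmoid_lt_one x))

theorem sigmoidDeriv_le_sigmoid (x : ℝ) : sigmoidDeriv x ≤ Real.sigmoid x :=
  mul_le_of_le_one_right (Real.sigmoid_nonneg x) (by linarith [Real.sigmoid_pos x])

theorem continuous_sigmoidDeriv : Continuous sigmoidDeriv :=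
  continuous_sigmoid.mul (continuous_const.sub continuous_sigmoid)

/-- Along a gradient descent with bounded driving terms the total step size diverges: otherwise
both the edge and the orientation parameter would converge, with a positive limiting step size. -/
theorem not_summable_step {γ θ u r : ℕ → ℝ} {C D : ℝ} (hu : ∀ t, |u t| ≤ C)
    (hr : ∀ t, |r t| ≤ D)
    (hγ : ∀ t, γ (t + 1) = γ t + sigmoidDeriv (γ t) * Real.sigmoid (θ t) * u t)
    (hθ : ∀ t, θ (t + 1) = θ t + sigmoidDeriv (θ t) * r t) :
    ¬ Summable fun t => sigmoidDeriv (γ t) * Real.sigmoid (θ t) := by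
  intro hsum
  have hs : ∀ t, 0 ≤ sigmoidDeriv (γ t) * Real.sigmoid (θ t) := fun t =>
    mul_nonneg (sigmoidDeriv_pos _).le (Real.sigmoid_nonneg _)
  obtain ⟨Γ, hΓ⟩ := exists_tendsto_of_step hs hsum hu hγ
  have hc := (continuous_sigmoidDeriv.tendsto Γ).comp hΓ
  -- Since `γ` converges, `σ'(γ t)` eventually exceeds half its positive limit, so the summability
  -- of the step sizes falls on the factor `σ(θ t)`.
  have hsθ : Summable fun t => Real.sigmoid (θ t) := by
    obtain ⟨N, hN⟩ := eventually_atTop.1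
      (hc.eventually (lt_mem_nhds (half_lt_self (sigmoidDeriv_pos Γ))))
    rw [← summable_nat_add_iff N] at hsum ⊢
    refine Summable.of_nonneg_of_le (fun t => Real.sigmoid_nonneg _) (fun t => ?_)
      (hsum.mul_left (sigmoidDeriv Γ / 2)⁻¹)
    have hpos := half_pos (sigmoidDeriv_pos Γ)
    rw [le_inv_mul_iff₀ hpos]
    exact mul_le_mul_of_nonneg_right (hN _ (Nat.le_add_left _ _)).le (Real.sigmoid_nonneg _)
  -- The steps of `θ` are weighted by `σ'(θ) ≤ σ(θ)`, hence are summable too. The limit `σ(Θ) > 0`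
  -- then contradicts the summability of `σ(θ t)`.
  obtain ⟨Θ, hΘ⟩ := exists_tendsto_of_step (fun t => (sigmoidDeriv_pos (θ t)).le)
    (hsθ.of_nonneg_of_le (fun t => (sigmoidDeriv_pos _).le) fun t => sigmoidDeriv_le_sigmoid _)
    hr hθ
  exact (Real.sigmoid_pos Θ).ne' (tendsto_nhds_unique
    ((continuous_sigmoid.tendsto Θ).comp hΘ) hsθ.tendsto_atTop_zero)

end Descent

/-! ### Marginal integrals of products over acyclic graphs -/

section LMarginal

variable {ι : Type*} [DecidableEq ι] {X : ι → Type*} [∀ n, MeasurableSpace (X n)]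
  {μ : ∀ n, Measure (X n)}

theorem lmarginal_mul_left {F G : (∀ n, X n) → ℝ≥0∞} {s : Finset ι} {t : Set ι}
    (hF : DependsOn F t) (hst : Disjoint t s) [∀ n, SigmaFinite (μ n)] (hG : Measurable G) :
    lmarginal μ s (fun x => F x * G x) = fun x => F x * lmarginal μ s G x := by
  ext x
  have h : ∀ z : ∀ n : s, X n, F (Function.updateFinset x s z) = F x := fun z =>
    hF fun m hm => by
      have : m ∉ s := fun h => Set.disjoint_left.1 hst hm h
      simp [Function.updateFinset, this]
  simp only [lmarginal, h]
  exact lintegral_const_mul _ (hG.comp measurable_updateFinset)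

/-- The product of a family of conditional densities over an acyclic graph integrates to one. -/
theorem lmarginal_prod_eq_one [Finite ι] [∀ n, SigmaFinite (μ n)] {pa : ι → Finset ι}
    (hpa : ∀ n, ¬ Relation.TransGen (fun a b => a ∈ pa b) n n) {h : ι → (∀ n, X n) → ℝ≥0∞}
    (hmeas : ∀ n, Measurable (h n))
    (hdep : ∀ n, DependsOn (h n) (insert n (pa n : Set ι)))
    (hint : ∀ n x, ∫⁻ y, h n (Function.update x n y) ∂(μ n) = 1) (s : Finset ι) :
    lmarginal μ s (fun x => ∏ n ∈ s, h n x) = 1 := by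
  induction s using Finset.strongInduction with
  | H s ih =>
    rcases s.eq_empty_or_nonempty with rfl | hs
    · ext; simp
    have : IsTrans ι (Relation.TransGen fun a b => a ∈ pa b) := ⟨fun _ _ _ => .trans⟩
    have : Std.Irrefl (Relation.TransGen fun a b => a ∈ pa b) := ⟨hpa⟩
    -- A sink of the graph restricted to `s`: among the factors indexed by `s`, only the one of `n`
    -- involves the coordinate `n`, so integrating this coordinate first removes exactly that
    -- factor.
    obtain ⟨n, hn, hmax⟩ := (Finite.wellFounded_of_trans_of_irrefl
      (Function.swap (Relation.TransGen fun a b => a ∈ pa b))).has_min (s : Set ι) hs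
    rw [Finset.mem_coe] at hn
    rw [lmarginal_erase' _ (by fun_prop) hn, ← ih _ (Finset.erase_ssubset hn)]
    congr 1
    ext x
    have h1 : ∀ y, ∏ m ∈ s, h m (Function.update x n y) =
        (∏ m ∈ s.erase n, h m x) * h n (Function.update x n y) := by
      intro y
      rw [← Finset.prod_erase_mul _ _ hn]
      congr 1
      refine Finset.prod_congr rfl fun m hm => ?_
      rw [Finset.mem_erase] at hm
      refine hdep m fun k hk => Function.update_of_ne ?_ _ _
      rintro rfl
      rcases hk with hk | hk
      · exact hm.1 hk.symm
      · exact hmax m hm.2 (.single hk)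
    have h2 : Measurable fun y => h n (Function.update x n y) :=
      (hmeas n).comp (measurable_update x)
    simp only [h1]
    rw [lintegral_const_mul _ h2, hint, mul_one]

/-- An almost everywhere inequality between functions that depend only on the coordinates in `s`
is preserved by integrating these coordinates. -/
theorem lmarginal_mono_ae [Fintype ι] [∀ n, SigmaFinite (μ n)] {r : ∀ n, X n → ℝ≥0∞}
    (hr : ∀ n, Measurable (r n)) (hr1 : ∀ n, ∫⁻ y, r n y ∂(μ n) = 1)
    {F G : (∀ n, X n) → ℝ≥0∞} {s : Finset ι} (hF : Measurable F) (hG : Measurable G)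
    (hFs : DependsOn F s) (hGs : DependsOn G s) (hFG : F ≤ᵐ[Measure.pi μ] G) (x : ∀ n, X n) :
    lmarginal μ s F x ≤ lmarginal μ s G x := by
  -- The reference measures may be infinite, so the coordinates outside `s` are weighted by the
  -- probability densities `r n` (a model on the edgeless graph). This turns the marginal integral
  -- at one point into an integral over the whole space, where the almost everywhere inequality can
  -- be used.
  have hR : lmarginal μ sᶜ (fun x => ∏ n ∈ sᶜ, r n (x n)) = 1 :=
    lmarginal_prod_eq_one (pa := fun _ => ∅) (h := fun n x => r n (x n))
      (fun n h => by
        obtain ⟨_, _, h⟩ := Relation.TransGen.tail'_iff.1 h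
        simp at h)
      (fun n => (hr n).comp (measurable_pi_apply n))
      (fun n x y hxy => by simp [hxy n (by simp)]) (fun n x => by simpa using hr1 n) _
  have key : ∀ {H : (∀ n, X n) → ℝ≥0∞}, Measurable H → DependsOn H s →
      ∫⁻ x, H x * ∏ n ∈ sᶜ, r n (x n) ∂(Measure.pi μ) = lmarginal μ s H x := by
    intro H hH hHs
    rw [lintegral_eq_lmarginal_univ x, ← Finset.union_compl s,
      lmarginal_union _ _ (by fun_prop) disjoint_compl_right,
      lmarginal_mul_left hHs (by simpa using disjoint_compl_right) (by fun_prop), hR]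
    simp
  rw [← key hF hFs, ← key hG hGs]
  exact lintegral_mono_ae (hFG.mono fun x hx => mul_le_mul_left hx _)

end LMarginal

/-! ### Observational and interventional marginals -/

section Gibbs

set_option linter.unusedSectionVars false

variable {V L : Type*} [Fintype V] [DecidableEq V] [Fintype L] [DecidableEq L]
variable {Ω : V ⊕ L → Type*} [∀ n, MeasurableSpace (Ω n)]
variable {μ : ∀ n : V ⊕ L, Measure (Ω n)} (M : CausalModel μ)

namespace CausalModel

theorem nodes_mono {S T : Finset V} (h : S ⊆ T) : nodes (L := L) S ⊆ nodes T :=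
  Finset.map_subset_map.2 h

theorem inl_mem_nodes {k : V} {S : Finset V} : Sum.inl k ∈ nodes (L := L) S ↔ k ∈ S := by
  simp [nodes]

theorem nodes_insert (k : V) (S : Finset V) :
    nodes (L := L) (insert k S) = insert (Sum.inl k) (nodes S) := by
  simp [nodes]

theorem notMem_obsPa_self (j : V) : j ∉ M.obsPa j := fun h =>
  M.acyclic (Sum.inl j) (.single (by simpa [obsPa] using h))

theorem notMem_obsPa {M : CausalModel μ} {i j : V} (h : ¬ M.IsAncestor (Sum.inl i) (Sum.inl j)) :
    i ∉ M.obsPa j := fun hi =>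
  h (.single (by simpa [obsPa] using hi))

@[fun_prop]
theorem measurable_mech_coe (n : V ⊕ L) : Measurable fun x => (M.mech n x : ℝ≥0∞) :=
  measurable_coe_nnreal_ennreal.comp (M.measurable_mech n)

@[fun_prop]
theorem measurable_intv_coe (k : V) :
    Measurable fun x : ∀ n, Ω n => (M.intv k (x (Sum.inl k)) : ℝ≥0∞) :=
  measurable_coe_nnreal_ennreal.comp ((M.measurable_intv k).comp (measurable_pi_apply _))

@[fun_prop]
theorem measurable_obsDensity : Measurable M.obsDensity := by
  unfold obsDensity
  fun_prop

@[fun_prop]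
theorem measurable_intDensity (k : V) : Measurable (M.intDensity k) := by
  unfold intDensity
  fun_prop

theorem dependsOn_prod_mech {D : Finset (V ⊕ L)} (hD : ∀ n ∈ D, M.pa n ⊆ D) :
    DependsOn (fun x => ∏ n ∈ D, (M.mech n x : ℝ≥0∞)) (D : Set (V ⊕ L)) := by
  intro x y hxy
  refine Finset.prod_congr rfl fun n hn => ?_
  rw [M.dependsOn_mech n fun m hm => hxy m ?_]
  rcases hm with rfl | hm
  · exact hn
  · exact hD n hn hm

theorem expNLL_sub_expNLL {M : CausalModel μ} {f : CondFamily Ω} {i j k : V} {S : Finset V} (hfin : M.FiniteLogLik f j) (hkj : k ≠ j)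
    (hij : i ≠ j) (hj : j ∉ S) :
    M.expNLL f k j (insert i S) - M.expNLL f k j S = - M.expGain f k i j S := by
  rw [expNLL, expNLL, expGain, integral_sub (hfin k hkj _ (by simp [hij.symm, hj])).2
    (hfin k hkj _ hj).2, integral_neg, integral_neg]
  ring

variable [∀ n, SigmaFinite (μ n)]

@[fun_prop]
theorem measurable_marginal (A : Finset (V ⊕ L)) : Measurable (M.marginal A) :=
  M.measurable_obsDensity.lmarginal μ

theorem dependsOn_marginal (A : Finset (V ⊕ L)) : DependsOn (M.marginal A) (A : Set (V ⊕ L)) :=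
  fun _ _ hxy => lmarginal_congr μ M.obsDensity fun n hn => hxy n (by simpa using hn)

theorem lmarginal_prod_mech (s : Finset (V ⊕ L)) :
    lmarginal μ s (fun x => ∏ n ∈ s, (M.mech n x : ℝ≥0∞)) = 1 :=
  lmarginal_prod_eq_one M.acyclic M.measurable_mech_coe
    (fun n x y hxy => by simp only [M.dependsOn_mech n hxy]) M.lintegral_mech s

theorem lintegral_obsDensity [Nonempty (∀ n, Ω n)] :
    ∫⁻ x, M.obsDensity x ∂(Measure.pi μ) = 1 := by
  obtain ⟨x⟩ := ‹Nonempty (∀ n, Ω n)›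
  rw [lintegral_eq_lmarginal_univ x]
  exact congrFun (M.lmarginal_prod_mech Finset.univ) x

/-- A perfect intervention yields another family of conditional densities, over the graph with the
edges into `X_k` deleted; deleting edges preserves acyclicity. -/
theorem lintegral_intDensity [Nonempty (∀ n, Ω n)] (k : V) :
    ∫⁻ x, M.intDensity k x ∂(Measure.pi μ) = 1 := by
  obtain ⟨x⟩ := ‹Nonempty (∀ n, Ω n)›
  rw [lintegral_eq_lmarginal_univ x]
  have h := lmarginal_prod_eq_one (μ := μ)
    (pa := fun n => if n = Sum.inl k then ∅ else M.pa n)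
    (h := fun n x => if n = Sum.inl k then (M.intv k (x (Sum.inl k)) : ℝ≥0∞) else M.mech n x)
    (fun n hn => M.acyclic n (Relation.TransGen.mono (fun a b (hab : a ∈ ite _ _ _) => by
      split_ifs at hab
      · simp at hab
      · exact hab) n n hn))
    (fun n => by split_ifs <;> fun_prop)
    (fun n x y hxy => by
      dsimp only at hxy ⊢
      split_ifs at hxy ⊢ with hn
      · subst hn
        rw [hxy _ (by simp)]
      · rw [M.dependsOn_mech n hxy])
    (fun n x => by
      by_cases hn : n = Sum.inl k
      · subst hn
        simpa using M.lintegral_intv k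
      · simpa [hn] using M.lintegral_mech n x) Finset.univ
  refine Eq.trans (congrFun (congrArg (lmarginal μ Finset.univ) ?_) x) (congrFun h x)
  ext z
  rw [intDensity, ← Finset.mul_prod_erase _ _ (Finset.mem_univ (Sum.inl k))]
  simp only [if_true]
  congr 1
  exact Finset.prod_congr rfl fun n hn => (if_neg (Finset.ne_of_mem_erase hn)).symm

theorem isProbabilityMeasure_intMeasure [Nonempty (∀ n, Ω n)] (k : V) :
    IsProbabilityMeasure (M.intMeasure k) :=
  ⟨by rw [intMeasure, withDensity_apply _ .univ, setLIntegral_univ, M.lintegral_intDensity]⟩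

/-- The marginal of an ancestral set `D` is the product of the mechanisms of `D`. -/
theorem marginal_eq_of_subset_ancestral {A D : Finset (V ⊕ L)} (hD : ∀ n ∈ D, M.pa n ⊆ D)
    (hA : A ⊆ D) :
    M.marginal A = lmarginal μ (D \ A) fun x => ∏ n ∈ D, (M.mech n x : ℝ≥0∞) := by
  have h1 : Aᶜ = (D \ A) ∪ Dᶜ := by
    ext n
    have := @hA n
    simp only [Finset.mem_compl, Finset.mem_union, Finset.mem_sdiff]
    tauto
  have h2 : Disjoint (D \ A) Dᶜ := disjoint_compl_right.mono_left Finset.sdiff_subset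
  rw [marginal, h1, lmarginal_union _ _ M.measurable_obsDensity h2]
  congr 1
  -- The factors from `D` do not involve coordinates outside `D`, so these can be integrated first;
  -- the remaining mechanisms then contribute one.
  have h3 : M.obsDensity =
      fun x => (∏ n ∈ D, (M.mech n x : ℝ≥0∞)) * ∏ n ∈ Dᶜ, (M.mech n x : ℝ≥0∞) := by
    ext x
    rw [obsDensity, Finset.prod_mul_prod_compl]
  rw [h3, lmarginal_mul_left (M.dependsOn_prod_mech hD)
    (by simpa using disjoint_compl_right) (by fun_prop), M.lmarginal_prod_mech]
  simp

/-- Under the intervention on `X_i`, the variables of an ancestral set not containing `X_i` keep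
their observational distribution and are independent of `X_i`. -/
theorem lmarginal_intDensity {A D : Finset (V ⊕ L)} (hD : ∀ n ∈ D, M.pa n ⊆ D) (hA : A ⊆ D)
    {i : V} (hi : Sum.inl i ∉ D) :
    lmarginal μ (insert (Sum.inl i) A)ᶜ (M.intDensity i) =
      fun x => (M.intv i (x (Sum.inl i)) : ℝ≥0∞) * M.marginal A x := by
  have h1 : (insert (Sum.inl i) A)ᶜ = (D \ A) ∪ (insert (Sum.inl i) D)ᶜ := by
    ext n
    have := @hA n
    by_cases hn : n = Sum.inl i
    · subst hn
      simp [hi]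
    · simp only [Finset.mem_compl, Finset.mem_union, Finset.mem_sdiff, Finset.mem_insert, hn]
      tauto
  have h2 : Disjoint (D \ A) (insert (Sum.inl i) D)ᶜ :=
    disjoint_compl_right.mono_left (Finset.sdiff_subset.trans (Finset.subset_insert _ _))
  have h3 : M.intDensity i = fun x => ((M.intv i (x (Sum.inl i)) : ℝ≥0∞) *
      ∏ n ∈ D, (M.mech n x : ℝ≥0∞)) * ∏ n ∈ (insert (Sum.inl i) D)ᶜ, (M.mech n x : ℝ≥0∞) := by
    ext x
    rw [intDensity, mul_assoc, ← Finset.prod_union]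
    · congr 2
      ext n
      by_cases hn : n = Sum.inl i
      · subst hn
        simp [hi]
      · simp [hn, em]
    · exact disjoint_compl_right.mono_left (Finset.subset_insert _ _)
  have h4 : DependsOn (fun x : ∀ n, Ω n => (M.intv i (x (Sum.inl i)) : ℝ≥0∞))
      {(Sum.inl i : V ⊕ L)} := fun x y hxy => by simp only [hxy (Sum.inl i) rfl]
  have h5 : DependsOn (fun x => (M.intv i (x (Sum.inl i)) : ℝ≥0∞) *
      ∏ n ∈ D, (M.mech n x : ℝ≥0∞)) (insert (Sum.inl i) D : Finset (V ⊕ L)) := fun x y hxy => by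
    dsimp only
    rw [hxy (Sum.inl i) (by simp)]
    congr 1
    exact M.dependsOn_prod_mech hD fun n hn => hxy n (by simpa using Or.inr hn)
  rw [h1, lmarginal_union _ _ (M.measurable_intDensity i) h2, h3,
    lmarginal_mul_left h5 (by exact_mod_cast disjoint_compl_right) (by fun_prop),
    M.lmarginal_prod_mech, M.marginal_eq_of_subset_ancestral hD hA]
  simp only [Pi.one_apply, mul_one]
  exact lmarginal_mul_left h4 (by simp [hi]) (by fun_prop)

/-! ### Gibbs' inequality under the intervention on a non-ancestor -/

variable {M} {f : CondFamily Ω}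

/-- Under the intervention on `X_i`, the likelihood ratio of `X_j` of any conditional density given
`X_S, X_i` to the observational one given `X_S` has expectation at most one, if `X_i` does not
belong to an ancestral set containing `X_j` and `X_S`. -/
theorem lintegral_ratio_le_one [Nonempty (∀ n, Ω n)] (hf : M.IsObsConditional f) {i j : V}
    {S : Finset V} {D : Finset (V ⊕ L)} (hD : ∀ n ∈ D, M.pa n ⊆ D)
    (hS : nodes (insert j S) ⊆ D) (hi : Sum.inl i ∉ D) (hj : j ∉ S) :
    ∫⁻ x, ((f j (insert i S) x / f j S x : ℝ≥0) : ℝ≥0∞) ∂(M.intMeasure i) ≤ 1 := by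
  have hij : i ≠ j := by
    rintro rfl
    exact hi (hS (inl_mem_nodes.2 (Finset.mem_insert_self _ _)))
  have hiS : i ∉ S := fun h => hi (hS (inl_mem_nodes.2 (Finset.mem_insert_of_mem h)))
  have hjS : j ∉ insert i S := by simp [hij.symm, hj]
  have hfm := hf.measurable j S hj
  have hgm := hf.measurable j (insert i S) hjS
  have hfd := hf.dependsOn j S hj
  have hgd := hf.dependsOn j (insert i S) hjS
  obtain ⟨x⟩ := id ‹Nonempty (∀ n, Ω n)›
  set s : Finset (V ⊕ L) := insert (Sum.inl i) (nodes (insert j S)) with hs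
  have hsub : nodes (insert j (insert i S)) = s := by
    rw [hs, Finset.insert_comm, nodes_insert]
  rw [hsub] at hgd
  have hfd' : DependsOn (f j S) (s : Set (V ⊕ L)) := hfd.mono (by simp [hs])
  have hmd : ∀ {T : Finset V}, T ⊆ insert j S → DependsOn (fun x =>
      (M.intv i (x (Sum.inl i)) : ℝ≥0∞) * M.marginal (nodes T) x) (s : Set (V ⊕ L)) := by
    intro T hT x y hxy
    dsimp only
    rw [hxy (Sum.inl i) (by simp [hs]), M.dependsOn_marginal (nodes T) fun n hn => hxy n ?_]
    exact Finset.mem_coe.2 (Finset.mem_insert_of_mem (nodes_mono hT hn))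
  -- The auxiliary probability densities for `lmarginal_mono_ae`: the mechanisms, with the parents
  -- frozen at the base point `x`.
  have hpos : ∀ n, ∃ r : Ω n → ℝ≥0∞, Measurable r ∧ ∫⁻ y, r y ∂(μ n) = 1 := fun n =>
    ⟨fun y => M.mech n (Function.update x n y),
      (M.measurable_mech_coe n).comp (measurable_update x), M.lintegral_mech n x⟩
  choose r hr hr1 using hpos
  -- Reduce to the coordinates i, j, S, where the interventional density is `p̃_i(x_i) p(x_j, x_S)`.
  -- Factoring `p(x_j, x_S) = f(x_j | x_S) p(x_S)` cancels the denominator; then `x_j`, `x_i` and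
  -- `x_S` integrate to one in this order. Of the numerator's defining properties, only its
  -- normalisation in `x_j` matters, not its relation to the joint law.
  calc ∫⁻ x, ((f j (insert i S) x / f j S x : ℝ≥0) : ℝ≥0∞) ∂(M.intMeasure i)
      = ∫⁻ x, ((f j (insert i S) x / f j S x : ℝ≥0) : ℝ≥0∞) * M.intDensity i x
          ∂(Measure.pi μ) := by
        rw [intMeasure, lintegral_withDensity_eq_lintegral_mul _ (M.measurable_intDensity i)
          (by fun_prop)]
        exact lintegral_congr fun x => mul_comm _ _
    _ = lmarginal μ s (fun x => ((f j (insert i S) x / f j S x : ℝ≥0) : ℝ≥0∞) *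
          ((M.intv i (x (Sum.inl i)) : ℝ≥0∞) * M.marginal (nodes (insert j S)) x)) x := by
        rw [lintegral_eq_lmarginal_univ x, ← Finset.union_compl s,
          lmarginal_union _ _ (by fun_prop) disjoint_compl_right,
          lmarginal_mul_left (t := s) (fun x y hxy => by rw [hgd hxy, hfd' hxy])
            (by exact_mod_cast disjoint_compl_right) (by fun_prop),
          hs, M.lmarginal_intDensity hD hS hi]
    _ ≤ lmarginal μ s (fun x => (f j (insert i S) x : ℝ≥0∞) *
          ((M.intv i (x (Sum.inl i)) : ℝ≥0∞) * M.marginal (nodes S) x)) x := by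
        refine lmarginal_mono_ae hr hr1 (by fun_prop) (by fun_prop)
          (fun x y hxy => ?_) (fun x y hxy => ?_) ?_ x
        · have := hmd subset_rfl hxy
          dsimp only at this ⊢
          rw [hgd hxy, hfd' hxy, this]
        · have := hmd (Finset.subset_insert j S) hxy
          dsimp only at this ⊢
          rw [hgd hxy, this]
        · filter_upwards [hf.mul_marginal j S hj] with x hx
          -- Only an inequality: where the denominator vanishes, the quotient is zero by convention
          -- while the right side may be positive.
          have : ((f j (insert i S) x / f j S x : ℝ≥0) : ℝ≥0∞) * f j S x ≤ f j (insert i S) x := by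
            norm_cast
            rcases eq_or_ne (f j S x) 0 with h | h
            · simp [h]
            · rw [div_mul_cancel₀ _ h]
          rw [← hx]
          calc _ = (((f j (insert i S) x / f j S x : ℝ≥0) : ℝ≥0∞) * f j S x) *
                ((M.intv i (x (Sum.inl i)) : ℝ≥0∞) * M.marginal (nodes S) x) := by ring
            _ ≤ _ := mul_le_mul_left this _
    _ = lmarginal μ (insert (Sum.inl i) (nodes S))
          (fun x => (M.intv i (x (Sum.inl i)) : ℝ≥0∞) * M.marginal (nodes S) x) x := by
        rw [hs, nodes_insert, Finset.insert_comm,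
          lmarginal_insert' _ (by fun_prop) (by simp [hij.symm, inl_mem_nodes, hj])]
        congr 2
        ext z
        have h1 : ∀ y, (Function.update z (Sum.inl j) y) (Sum.inl i) = z (Sum.inl i) := fun y =>
          Function.update_of_ne (by simpa using hij) _ _
        have h2 : ∀ y, M.marginal (nodes S) (Function.update z (Sum.inl j) y) =
            M.marginal (nodes S) z := fun y =>
          lmarginal_update_of_mem μ (by simp [inl_mem_nodes, hj]) M.obsDensity _ _
        have h3 : Measurable fun y =>
            (f j (insert i S) (Function.update z (Sum.inl j) y) : ℝ≥0∞) :=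
          measurable_coe_nnreal_ennreal.comp (hgm.comp (measurable_update z))
        simp only [h1, h2]
        rw [lintegral_mul_const _ h3, hf.lintegral j _ hjS, one_mul]
    _ = lmarginal μ (nodes S) (M.marginal (nodes S)) x := by
        rw [lmarginal_insert' _ (by fun_prop) (by simp [inl_mem_nodes, hiS])]
        congr 2
        ext z
        have h2 : ∀ y, M.marginal (nodes S) (Function.update z (Sum.inl i) y) =
            M.marginal (nodes S) z := fun y =>
          lmarginal_update_of_mem μ (by simp [inl_mem_nodes, hiS]) M.obsDensity _ _
        have h3 : Measurable fun y => (M.intv i y : ℝ≥0∞) :=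
          measurable_coe_nnreal_ennreal.comp (M.measurable_intv i)
        simp only [h2, Function.update_self]
        rw [lintegral_mul_const _ h3, M.lintegral_intv, one_mul]
    _ = 1 := by
        rw [marginal, ← lmarginal_union _ _ M.measurable_obsDensity disjoint_compl_right,
          Finset.union_compl, ← lintegral_eq_lmarginal_univ, M.lintegral_obsDensity]

/-- Gibbs' inequality: if `X_i` is not an ancestor of `X_j`, then under the intervention on `X_i`
the likelihood of `X_j` given its observed parents does not improve by adding `X_i`. -/
theorem expGain_self_nonpos (hf : M.IsObsConditional f) {i j : V} (hne : i ≠ j)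
    (hij : ¬ M.IsAncestor (Sum.inl i) (Sum.inl j)) (hfin : M.FiniteLogLik f j) :
    M.expGain f i i j (M.obsPa j) ≤ 0 := by
  classical
  rcases isEmpty_or_nonempty (∀ n, Ω n) with hΩ | hΩ
  · simp [expGain, Measure.eq_zero_of_isEmpty]
  have := M.isProbabilityMeasure_intMeasure i
  have hj := M.notMem_obsPa_self j
  have hjS : j ∉ insert i (M.obsPa j) := by simp [hne.symm, hj]
  -- The ancestral set consists of `X_j` and all its ancestors, latent ones included.
  have hratio := lintegral_ratio_le_one hf (i := i) (j := j) (S := M.obsPa j)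
    (D := Finset.univ.filter fun n => n = Sum.inl j ∨ M.IsAncestor n (Sum.inl j))
    (fun n hn m hm => by
      simp only [Finset.mem_filter, Finset.mem_univ, true_and] at hn ⊢
      rcases hn with rfl | hn
      · exact Or.inr (.single hm)
      · exact Or.inr (.head hm hn))
    (fun n hn => by
      simp only [Finset.mem_filter, Finset.mem_univ, true_and]
      simp only [nodes, Finset.mem_map, Finset.mem_insert, Function.Embedding.inl_apply] at hn
      obtain ⟨k, rfl | hk, rfl⟩ := hn
      · exact Or.inl rfl
      · exact Or.inr (.single (by simpa [obsPa] using hk)))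
    (by simpa [hne] using hij) hj
  obtain ⟨hpos1, hint1⟩ := hfin i hne _ hj
  obtain ⟨hpos2, hint2⟩ := hfin i hne _ hjS
  have hm : Measurable fun x => f j (insert i (M.obsPa j)) x / f j (M.obsPa j) x :=
    (hf.measurable j _ hjS).div (hf.measurable j _ hj)
  have hint : Integrable (fun x => ((f j (insert i (M.obsPa j)) x / f j (M.obsPa j) x : ℝ≥0) : ℝ))
      (M.intMeasure i) := by
    refine ⟨hm.coe_nnreal_real.aestronglyMeasurable, ?_⟩
    rw [hasFiniteIntegral_iff_ofReal (.of_forall fun x => NNReal.coe_nonneg _)]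
    simp only [ENNReal.ofReal_coe_nnreal]
    exact hratio.trans_lt ENNReal.one_lt_top
  have h1 : ∫ x, ((f j (insert i (M.obsPa j)) x / f j (M.obsPa j) x : ℝ≥0) : ℝ)
      ∂(M.intMeasure i) ≤ 1 := by
    rw [integral_eq_lintegral_of_nonneg_ae (.of_forall fun x => NNReal.coe_nonneg _) hint.1]
    simp only [ENNReal.ofReal_coe_nnreal]
    exact ENNReal.toReal_le_of_le_ofReal zero_le_one (by simpa using hratio)
  -- Apply `log r ≤ r - 1` to the likelihood ratio `r`, whose mean is at most one. Both likelihoods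
  -- are almost surely positive, so the difference of logarithms is `log r`.
  calc M.expGain f i i j (M.obsPa j)
      ≤ ∫ x, (((f j (insert i (M.obsPa j)) x / f j (M.obsPa j) x : ℝ≥0) : ℝ) - 1)
          ∂(M.intMeasure i) := by
        refine integral_mono_ae (hint2.sub hint1) (hint.sub (integrable_const 1)) ?_
        filter_upwards [hpos1, hpos2] with x hx1 hx2
        have hx1' : (0 : ℝ) < f j (M.obsPa j) x := hx1
        have hx2' : (0 : ℝ) < f j (insert i (M.obsPa j)) x := hx2
        rw [← Real.log_div hx2'.ne' hx1'.ne', NNReal.coe_div]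
        exact Real.log_le_sub_one_of_pos (div_pos hx2' hx1')
    _ ≤ 0 := by
        rw [integral_sub hint (integrable_const 1)]
        simpa using h1

end CausalModel

end Gibbs

/-! ### Limits of the driving terms and divergence of the edge parameters -/

section Limits

set_option linter.unusedSectionVars false

variable {V L : Type*} [Fintype V] [DecidableEq V] [Fintype L] [DecidableEq L]
variable {Ω : V ⊕ L → Type*} [∀ n, MeasurableSpace (Ω n)]
variable {μ : ∀ n : V ⊕ L, Measure (Ω n)} {M : CausalModel μ} {f : CausalModel.CondFamily Ω}
  {pI : V → ℝ} {lam ηγ ηθ : ℝ} {P : ℕ → Params V} {i j k : V}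

open CausalModel

/-- The law of the sampled parent set converges to the point mass at `M.obsPa j`, which lies in
`others i j` because `X_i` is not a parent of `X_j`. The sum over sets is finite, so limits pass
through it. -/
theorem tendsto_lossDiff (hfin : M.FiniteLogLik f j) (hne : i ≠ j) (hkj : k ≠ j)
    (hij : ¬ M.IsAncestor (Sum.inl i) (Sum.inl j)) (hrec : ParentsRecovered M P i j) :
    Tendsto (fun t => lossDiff M f (P t).γ (P t).θ k i j) atTop
      (𝓝 (- M.expGain f k i j (M.obsPa j))) := by
  have hsub : M.obsPa j ⊆ others i j := fun m hm => by
    simp only [others, Finset.mem_erase, Finset.mem_univ, and_true]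
    exact ⟨fun h => M.notMem_obsPa_self j (h ▸ hm), fun h => notMem_obsPa hij (h ▸ hm)⟩
  have hlim : Tendsto (fun t => lossDiff M f (P t).γ (P t).θ k i j) atTop
      (𝓝 (∑ S ∈ (others i j).powerset, ((∏ m ∈ S, if m ∈ M.obsPa j then (1 : ℝ) else 0) *
        ∏ m ∈ others i j \ S, (1 - if m ∈ M.obsPa j then (1 : ℝ) else 0)) *
          (M.expNLL f k j (insert i S) - M.expNLL f k j S))) := by
    refine tendsto_finsetSum _ fun S hS => Tendsto.mul_const _ (Tendsto.mul ?_ ?_)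
    · exact tendsto_finsetProd _ fun m hm => hrec m (Finset.mem_powerset.1 hS hm)
    · exact tendsto_finsetProd _ fun m hm => (hrec m (Finset.sdiff_subset hm)).const_sub 1
  convert hlim using 2
  rw [Finset.sum_eq_single_of_mem _ (Finset.mem_powerset.2 hsub)]
  · rw [Finset.prod_congr rfl fun m hm => if_pos hm,
      Finset.prod_congr (s₁ := others i j \ M.obsPa j) (g := fun _ => (1 : ℝ)) rfl
        fun m hm => by simp [(Finset.mem_sdiff.1 hm).2],
      expNLL_sub_expNLL hfin hkj hne (M.notMem_obsPa_self j)]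
    simp
  -- A wrong set either omits a true parent or contains a non-parent; in each case one factor of its
  -- limiting weight is zero.
  · intro S hS hSne
    by_cases h : S ⊆ M.obsPa j
    · obtain ⟨m, hm, hmS⟩ := Finset.exists_of_ssubset (h.ssubset_of_ne hSne)
      rw [Finset.prod_eq_zero (i := m) (s := others i j \ S)
        (Finset.mem_sdiff.2 ⟨hsub hm, hmS⟩) (by simp [hm])]
      simp
    · obtain ⟨m, hm, hmS⟩ := Finset.not_subset.1 h
      rw [Finset.prod_eq_zero hm (by simp [hmS])]
      simp

theorem exists_bound_lossDiff (hfin : M.FiniteLogLik f j) (hne : i ≠ j) (hkj : k ≠ j)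
    (hij : ¬ M.IsAncestor (Sum.inl i) (Sum.inl j)) (hrec : ParentsRecovered M P i j) :
    ∃ C, ∀ t, |lossDiff M f (P t).γ (P t).θ k i j| ≤ C := by
  obtain ⟨C, hC⟩ := (tendsto_lossDiff hfin hne hkj hij hrec).norm.bddAbove_range
  exact ⟨C, fun t => hC ⟨t, rfl⟩⟩

theorem lam_mul_sum_lt_of_lt_avgGain (hpI : ∀ k, 0 < pI k) (hlam : 0 < lam)
    (hgain : lam < M.avgGain f pI i j) :
    lam * ∑ k ∈ others i j, pI k < ∑ k ∈ others i j, pI k * M.expGain f k i j (M.obsPa j) := by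
  -- If the other targets carry no mass, `avgGain` is a division by zero, hence zero, and cannot
  -- exceed `lam > 0`.
  rcases (Finset.sum_nonneg fun k (_ : k ∈ others i j) => (hpI k).le).eq_or_lt with h | h
  · rw [avgGain, ← h, div_zero] at hgain
    exact absurd hgain hlam.not_gt
  · rwa [avgGain, lt_div_iff₀ h] at hgain

/-- If `X_i` is not an ancestor of `X_j` but informative about it, then the interventional part of
the edge parameter from `X_i` to `X_j` diverges to `-∞` and the observational part to `∞`. -/
theorem tendsto_edge_parameters [∀ n, SigmaFinite (μ n)] (hf : M.IsObsConditional f)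
    (hpI : ∀ k, 0 < pI k) (hlam : 0 < lam) (hηγ : 0 < ηγ) (hηθ : 0 < ηθ) (hne : i ≠ j)
    (hij : ¬ M.IsAncestor (Sum.inl i) (Sum.inl j)) (hji : ¬ M.IsAncestor (Sum.inl j) (Sum.inl i))
    (hfin_i : M.FiniteLogLik f i) (hfin_j : M.FiniteLogLik f j)
    (hP : IsRun M f pI lam ηγ ηθ P)
    (hrec_j : ParentsRecovered M P i j) (hrec_i : ParentsRecovered M P j i)
    (hgain : lam < M.avgGain f pI i j) :
    Tendsto (fun t => (P t).γI i j) atTop atBot ∧ Tendsto (fun t => (P t).γO i j) atTop atTop := by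
  -- `s` is the step size common to both parts of the edge parameter; `a` drives `γI i j` and `b`
  -- drives `γO i j`.
  set T : V → ℕ → ℝ := fun k t => lossDiff M f (P t).γ (P t).θ k i j with hT
  set s : ℕ → ℝ := fun t => sigmoidDeriv ((P t).γ i j) * Real.sigmoid ((P t).θ i j) with hs
  set a : ℕ → ℝ := fun t => -(ηγ * (pI i * (T i t + lam))) with ha
  set b : ℕ → ℝ := fun t => -(ηγ * ∑ k ∈ others i j, pI k * (T k t + lam)) with hb
  have hTlim : ∀ k, k ≠ j → Tendsto (T k) atTop (𝓝 (- M.expGain f k i j (M.obsPa j))) :=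
    fun k hk => tendsto_lossDiff hfin_j hne hk hij hrec_j
  have halim : Tendsto a atTop (𝓝 (-(ηγ * (pI i * (- M.expGain f i i j (M.obsPa j) + lam))))) :=
    (((hTlim i hne).add_const lam).const_mul _ |>.const_mul _).neg
  have hblim : Tendsto b atTop
      (𝓝 (-(ηγ * ∑ k ∈ others i j, pI k * (- M.expGain f k i j (M.obsPa j) + lam)))) :=
    ((tendsto_finsetSum _ fun k hk =>
      ((hTlim k (Finset.ne_of_mem_erase hk)).add_const lam).const_mul _).const_mul _).neg
  -- Gibbs' inequality may be an equality; strictness comes from `lam > 0`.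
  have haneg : -(ηγ * (pI i * (- M.expGain f i i j (M.obsPa j) + lam))) < 0 := by
    have := expGain_self_nonpos hf hne hij hfin_j
    exact neg_neg_of_pos (mul_pos hηγ (mul_pos (hpI i) (by linarith)))
  have hbpos : 0 < -(ηγ * ∑ k ∈ others i j, pI k * (- M.expGain f k i j (M.obsPa j) + lam)) := by
    have h1 := lam_mul_sum_lt_of_lt_avgGain hpI hlam hgain
    have h2 : ∑ k ∈ others i j, pI k * (- M.expGain f k i j (M.obsPa j) + lam) =
        lam * ∑ k ∈ others i j, pI k - ∑ k ∈ others i j, pI k * M.expGain f k i j (M.obsPa j) := by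
      rw [Finset.mul_sum, ← Finset.sum_sub_distrib]
      exact Finset.sum_congr rfl fun k _ => by ring
    rw [h2, neg_pos]
    exact mul_neg_of_pos_of_neg hηγ (by linarith)
  have hI : ∀ t, (P (t + 1)).γI i j = (P t).γI i j + s t * a t := fun t => by
    rw [hP.stepI t i j hne, edgeGrad]
    simp only [hs, ha, hT]
    ring
  have hO : ∀ t, (P (t + 1)).γO i j = (P t).γO i j + s t * b t := fun t => by
    rw [hP.stepO t i j hne]
    simp only [hs, hb, hT, edgeGrad]
    rw [mul_neg, mul_left_comm, Finset.mul_sum (a := _ * _), sub_eq_add_neg]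
    congr 3
    exact Finset.sum_congr rfl fun k _ => by ring
  have hs0 : ∀ t, 0 ≤ s t := fun t =>
    mul_nonneg (sigmoidDeriv_pos _).le (Real.sigmoid_nonneg _)
  obtain ⟨C, hC⟩ := (halim.add hblim).norm.bddAbove_range
  obtain ⟨D, hD⟩ := exists_bound_lossDiff hfin_j hne hne hij hrec_j
  obtain ⟨E, hE⟩ := exists_bound_lossDiff hfin_i hne.symm hne.symm hji hrec_i
  -- The full parameter `γ_ij` is driven by `a + b`, whose limit may have any sign, as may the drive
  -- of `θ_ij`; boundedness suffices. The bound for `θ_ij` uses `σ ≤ 1` and the bounds `D`, `E` on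
  -- the two loss differences, which is where recovery of the parents of `X_i` enters.
  have hns : ¬ Summable s := by
    refine not_summable_step (γ := fun t => (P t).γ i j) (θ := fun t => (P t).θ i j)
      (u := fun t => a t + b t) (D := ηθ * (pI i * D + pI j * E))
      (r := fun t => -(ηθ * (pI i * Real.sigmoid ((P t).γ i j) * T i t -
        pI j * Real.sigmoid ((P t).γ j i) * lossDiff M f (P t).γ (P t).θ j j i)))
      (fun t => hC ⟨t, rfl⟩) (fun t => ?_) (fun t => ?_) (fun t => ?_)
    · rw [abs_neg, abs_mul, abs_of_pos hηθ]
      refine mul_le_mul_of_nonneg_left ((abs_sub _ _).trans (add_le_add ?_ ?_)) hηθ.le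
      · rw [mul_assoc, abs_mul, abs_mul, abs_of_pos (hpI i), abs_of_pos (Real.sigmoid_pos _)]
        exact mul_le_mul_of_nonneg_left ((mul_le_of_le_one_left (abs_nonneg _)
          (Real.sigmoid_le_one _)).trans (hD t)) (hpI i).le
      · rw [mul_assoc, abs_mul, abs_mul, abs_of_pos (hpI j), abs_of_pos (Real.sigmoid_pos _)]
        exact mul_le_mul_of_nonneg_left ((mul_le_of_le_one_left (abs_nonneg _)
          (Real.sigmoid_le_one _)).trans (hE t)) (hpI j).le
    · simp only [Params.γ] at hI hO ⊢
      rw [hI, hO]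
      simp only [hs, Params.γ]
      ring
    · rw [hP.stepθ t i j hne, orientGrad]
      ring
  exact ⟨tendsto_atBot_of_step hs0 hns halim haneg hI, tendsto_atTop_of_step hs0 hns hblim hbpos hO⟩

end Limits

end ENCO

/-! ### Convergence of the confounder score -/

theorem mainTheorem5 {V L : Type*} [Fintype V] [DecidableEq V] [Fintype L] [DecidableEq L]
    {Ω : V ⊕ L → Type*} [∀ n, MeasurableSpace (Ω n)]
    {μ : ∀ n : V ⊕ L, Measure (Ω n)} [∀ n, SigmaFinite (μ n)]
    (M : ENCO.CausalModel μ)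
    -- the learned conditional densities, exact in the data limit
    (f : ENCO.CausalModel.CondFamily Ω) (hf : M.IsObsConditional f)
    -- the distribution over intervention targets, the sparsity weight and the learning rates
    (pI : V → ℝ) (hpI : ∀ k, 0 < pI k) (hpI_sum : ∑ k, pI k = 1)
    (lam ηγ ηθ : ℝ) (hlam : 0 < lam) (hηγ : 0 < ηγ) (hηθ : 0 < ηθ)
    -- a pair of observed variables with a latent confounder, not an ancestor-descendant pair
    (i j : V) (hne : i ≠ j) (l : L) (hl : M.IsLatentConfounder l i j)
    (hij : ¬ M.IsAncestor (Sum.inl i) (Sum.inl j)) (hji : ¬ M.IsAncestor (Sum.inl j) (Sum.inl i))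
    (hci : M.CondIndep (Sum.inl i) (Sum.inl j)
      (insert (Sum.inr l) (ENCO.CausalModel.nodes (M.obsPa i ∪ M.obsPa j))))
    (hfin_i : M.FiniteLogLik f i) (hfin_j : M.FiniteLogLik f j)
    -- a run of the algorithm along which the other edges are recovered
    (P : ℕ → ENCO.Params V) (hP : ENCO.IsRun M f pI lam ηγ ηθ P)
    (hrec_j : ENCO.ParentsRecovered M P i j) (hrec_i : ENCO.ParentsRecovered M P j i)
    -- the two conditions on the log-likelihood gains
    (hgain_ij : lam < M.avgGain f pI i j) (hgain_ji : lam < M.avgGain f pI j i) :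
    Tendsto (fun t => ENCO.lc (P t) i j) atTop (𝓝 1) ∧
    Tendsto (fun t => Real.sigmoid ((P t).γO i j)) atTop (𝓝 1) ∧
    Tendsto (fun t => Real.sigmoid ((P t).γO j i)) atTop (𝓝 1) ∧
    Tendsto (fun t => Real.sigmoid ((P t).γI i j)) atTop (𝓝 0) ∧
    Tendsto (fun t => Real.sigmoid ((P t).γI j i)) atTop (𝓝 0) := by
  obtain ⟨hI, hO⟩ := ENCO.tendsto_edge_parameters hf hpI hlam hηγ hηθ hne hij hji hfin_i hfin_j
    hP hrec_j hrec_i hgain_ij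
  obtain ⟨hI', hO'⟩ := ENCO.tendsto_edge_parameters hf hpI hlam hηγ hηθ hne.symm hji hij hfin_j
    hfin_i hP hrec_i hrec_j hgain_ji
  have h1 := Real.tendsto_sigmoid_atTop.comp hO
  have h2 := Real.tendsto_sigmoid_atTop.comp hO'
  have h3 := Real.tendsto_sigmoid_atBot.comp hI
  have h4 := Real.tendsto_sigmoid_atBot.comp hI'
  refine ⟨?_, h1, h2, h3, h4⟩
  simpa [ENCO.lc, Function.comp_def] using
    ((h1.mul h2).mul (h3.const_sub 1)).mul (h4.const_sub 1)
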